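/- Let $m\ge 1$ be an integer, let $1\le p<2$, let $\nu\ge 0$ be an integer and $0\le\alpha\le 1$. Let $\mathbb T^m=\mathbb R^m/2\pi\mathbb Z^m$. For an integrable function $f$ on $\mathbb T^m$ put $\widehat f(k)=(2\pi)^{-m}\int_{\mathbb T^m}f(t)e^{-i(k,t)}\,dt$, $k\in\mathbb Z^m$; let $A_p(\mathbb T^m)$ be the space of integrable (for $p=1$: continuous) functions $f$ on $\mathbb T^m$ with $\|f\|_{A_p(\mathbb T^m)}=\big(\sum_{k\in\mathbb Z^m}|\widehat f(k)|^p\big)^{1/p}<\infty$. Let $C^{\nu,0}(\mathbb T^m)=C^\nu(\mathbb T^m)$ and, for $0<\alpha\le 1$, let $C^{\nu,\alpha}(\mathbb T^m)$ be the class of functions on $\mathbb T^m$ that are $\nu$ times differentiable and all of whose partial derivatives $g$ of order $\nu$ (for $\nu=0$ the function itself) satisfy $\sup_{|s-t|\le\delta}|g(s)-g(t)|=O(\delta^\alpha)$ as $\delta\to+0$. Let $\varphi\in C^{\nu,\alpha}(\mathbb T^m)$ be a real function, and suppose that $\nu+\alpha\ge 1$ and $\nu+\alpha>m\left(\frac1p-\frac12\right)$.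 Then $e^{i\lambda\varphi}\in A_p(\mathbb T^m)$ for every $\lambda\in\mathbb R$, and $$\|e^{i\lambda\varphi}\|_{A_p(\mathbb T^m)}=O\!\left(|\lambda|^{m\left(\frac1p-\frac12\right)}\right),\qquad |\lambda|\to\infty,\ \lambda\in\mathbb R.$$ -/

import Mathlib

noncomputable section

namespace TorusAp

/-- `f` is `2π`-periodic with respect to each variable. Functions on the torus
`𝕋^m = ℝ^m / 2πℤ^m` are functions on `ℝ^m` with this property. -/
def IsPeriodic {m : ℕ} {Y : Type*} (f : EuclideanSpace ℝ (Fin m) → Y) : Prop :=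
  ∀ (j : Fin m) (t : EuclideanSpace ℝ (Fin m)),
    f (t + EuclideanSpace.single j (2 * Real.pi)) = f t

/-- The fundamental cube `[0, 2π]^m` of the torus. -/
def cube (m : ℕ) : Set (EuclideanSpace ℝ (Fin m)) :=
  {t | ∀ j, t j ∈ Set.Icc (0 : ℝ) (2 * Real.pi)}

/-- The Fourier coefficient `(2π)^{-m} ∫_{𝕋^m} f(t) e^{-i(k,t)} dt`. -/
def fourierCoef {m : ℕ} (f : EuclideanSpace ℝ (Fin m) → ℂ) (k : Fin m → ℤ) : ℂ :=
  (1 / (2 * (Real.pi : ℂ)) ^ m) *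
    ∫ t in cube m, f t * Complex.exp (-Complex.I * ((∑ j, (k j : ℝ) * t j : ℝ) : ℂ))

/-- Membership in `A_p(𝕋^m)`: an integrable function on the torus (continuous if `p = 1`) whose
Fourier coefficients belong to `l^p(ℤ^m)`. -/
def MemA {m : ℕ} (p : ℝ) (f : EuclideanSpace ℝ (Fin m) → ℂ) : Prop :=
  IsPeriodic f ∧ MeasureTheory.IntegrableOn f (cube m) ∧ (p = 1 → Continuous f) ∧
    Summable fun k : Fin m → ℤ => ‖fourierCoef f k‖ ^ p

/-- The norm `(∑_k |f̂(k)|^p)^{1/p}` of `A_p(𝕋^m)`; meaningful for `f` with `MemA p f`. -/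
def normA {m : ℕ} (p : ℝ) (f : EuclideanSpace ℝ (Fin m) → ℂ) : ℝ :=
  (∑' k : Fin m → ℤ, ‖fourierCoef f k‖ ^ p) ^ (1 / p)

/-- The Lipschitz condition of order `α`: the modulus of continuity
`ω(g, δ) = sup {|g(s) - g(t)| : |s - t| ≤ δ}` is `O(δ^α)` as `δ → +0`. -/
def LipOrder {m : ℕ} (α : ℝ) (g : EuclideanSpace ℝ (Fin m) → ℝ) : Prop :=
  ∃ C : ℝ, ∃ δ₀ : ℝ, 0 < δ₀ ∧ ∀ δ : ℝ, 0 < δ → δ ≤ δ₀ →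
    ∀ s t : EuclideanSpace ℝ (Fin m), ‖s - t‖ ≤ δ → |g s - g t| ≤ C * δ ^ α

/-- The partial derivative `∂^ν f / ∂t_{j 0} ⋯ ∂t_{j (ν-1)}` of order `ν`
(for `ν` times continuously differentiable `f`). -/
def partialDeriv {m : ℕ} (ν : ℕ) (j : Fin ν → Fin m) (f : EuclideanSpace ℝ (Fin m) → ℝ)
    (t : EuclideanSpace ℝ (Fin m)) : ℝ :=
  iteratedFDeriv ℝ ν f t fun i => EuclideanSpace.single (j i) (1 : ℝ)

/-- The real functions in `C^{ν,α}(𝕋^m)`: `f` is periodic and of class `C^ν` and, for `α > 0`, all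
its partial derivatives of order `ν` satisfy the Lipschitz condition of order `α`
(so `C^{ν,0} = C^ν`). -/
def MemC {m : ℕ} (ν : ℕ) (α : ℝ) (f : EuclideanSpace ℝ (Fin m) → ℝ) : Prop :=
  IsPeriodic f ∧ ContDiff ℝ ν f ∧
    (0 < α → ∀ j : Fin ν → Fin m, LipOrder α (partialDeriv ν j f))

end TorusAp

end

/-! Write `u = e^{iλφ}` and let `l = |λ| ≥ 1`. Each derivative of `u` along a coordinate axis costs
a factor `l`, so the derivatives `(l⁻¹ ∂_j)^r u`, `r ≤ ν`, are bounded uniformly in `l`, and the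
last one satisfies a Lipschitz condition of order `α` at scale `l⁻¹`. This is `SmoothFamily`;
`MemC.smoothFamily_exp` proves it from the equation `∂_j u = l · (±i ∂_j φ) · u` and closure under
products.

Bessel's inequality, applied to a difference with step `T⁻¹` of the last derivative, bounds the `ℓ²`
mass of the coefficients on a slab `T ≤ |k_j| ≤ 2T`, `T ≥ l`, by a multiple of `(l/T)^{2(ν+α)}`
(`SmoothFamily.exists_sum_sq_le`). Hölder's inequality on the dyadic shell at `T = 2^i l`, which has
`O(T^m)` points, turns this into an `ℓ^p` sum of order `l^γ · 2^{i(γ - p(ν+α))}` with `γ = m(1 -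
p/2)`. The hypothesis `m(1/p - 1/2) < ν + α` says exactly that these terms decay geometrically. The
central cube `|k_j| ≤ l` needs only Bessel and Hölder and also gives `l^γ` (`exists_sum_rpow_le`).
The `p`-th root of `l^γ` is the claimed rate. -/

namespace TorusAp

open MeasureTheory

variable {m : ℕ}

/-! ### Integration over the cube -/

theorem cube_eq_preimage (m : ℕ) :
    cube m = (WithLp.ofLp : EuclideanSpace ℝ (Fin m) → (Fin m → ℝ)) ⁻¹'
      (Set.univ.pi fun _ => Set.Icc 0 (2 * Real.pi)) := by
  ext t
  simp [cube, -Set.pi_univ_Icc]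

theorem setIntegral_cube_eq (g : EuclideanSpace ℝ (Fin m) → ℂ) :
    ∫ t in cube m, g t =
      ∫ x in (Set.univ.pi fun _ : Fin m => Set.Icc 0 (2 * Real.pi)), g (WithLp.toLp 2 x) := by
  have h := (PiLp.volume_preserving_ofLp (Fin m)).setIntegral_preimage_emb
    (MeasurableEquiv.toLp 2 (Fin m → ℝ)).symm.measurableEmbedding
    (fun x => g (WithLp.toLp 2 x)) (Set.univ.pi fun _ => Set.Icc 0 (2 * Real.pi))
  rw [cube_eq_preimage, ← h]

theorem isCompact_cube (m : ℕ) : IsCompact (cube m) := by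
  rw [cube_eq_preimage]
  exact (PiLp.homeomorph 2 (fun _ : Fin m => ℝ)).isCompact_preimage.2
    (isCompact_univ_pi fun _ => isCompact_Icc)

theorem volume_real_cube (m : ℕ) : volume.real (cube m) = (2 * Real.pi) ^ m := by
  rw [measureReal_def, cube_eq_preimage,
    (PiLp.volume_preserving_ofLp (Fin m)).measure_preimage
      (MeasurableSet.univ_pi fun _ => measurableSet_Icc).nullMeasurableSet, volume_pi_pi]
  simp [Real.volume_Icc, Real.pi_pos.le]

theorem integrableOn_cube {f : EuclideanSpace ℝ (Fin m) → ℂ} (hf : Continuous f) :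
    IntegrableOn f (cube m) :=
  hf.continuousOn.integrableOn_compact (isCompact_cube m)

theorem setIntegral_pi_eq_succAbove {n : ℕ} (j : Fin (n + 1)) {g : (Fin (n + 1) → ℝ) → ℂ}
    (hg : Continuous g) (s : Set ℝ) (hs : IsCompact s) :
    ∫ x in (Set.univ.pi fun _ => s), g x =
      ∫ y in (Set.univ.pi fun _ : Fin n => s), ∫ x in s, g (j.insertNth x y) := by
  set e := (MeasurableEquiv.piFinSuccAbove (fun _ : Fin (n + 1) => ℝ) j).symm
  have hem : MeasurePreserving e :=
    (volume_preserving_piFinSuccAbove (fun _ : Fin (n + 1) => ℝ) j).symm _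
  have he : ∀ z, e z = j.insertNth z.1 z.2 := fun z => rfl
  rw [← hem.setIntegral_preimage_emb e.measurableEmbedding]
  have hpre : e ⁻¹' (Set.univ.pi fun _ => s) = s ×ˢ (Set.univ.pi fun _ : Fin n => s) := by
    ext z
    simp only [Set.mem_preimage, he, Set.mem_pi, Set.mem_univ, true_imp_iff, Set.mem_prod]
    rw [Fin.forall_iff_succAbove j]
    simp
  rw [hpre, Measure.volume_eq_prod, ← setIntegral_prod_swap, setIntegral_prod]
  · rfl
  · refine ContinuousOn.integrableOn_compact ((isCompact_univ_pi fun _ => hs).prod hs) ?_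
    refine Continuous.continuousOn (hg.comp ?_)
    show Continuous fun z : (Fin n → ℝ) × ℝ => (j.insertNth z.2 z.1 : Fin (n + 1) → ℝ)
    fun_prop

/-- Translation along a coordinate axis does not change the integral of a periodic function. -/
theorem setIntegral_cube_translate {H : EuclideanSpace ℝ (Fin m) → ℂ} (hH : Continuous H)
    (hper : IsPeriodic H) (j : Fin m) (h : ℝ) :
    ∫ t in cube m, H (t + h • EuclideanSpace.single j (1 : ℝ)) = ∫ t in cube m, H t := by
  obtain _ | n := m
  · exact j.elim0
  have hcomp (x : ℝ) (y : Fin n → ℝ) :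
      (WithLp.toLp 2 (j.insertNth x y : Fin (n + 1) → ℝ) : EuclideanSpace ℝ (Fin (n + 1))) +
        h • EuclideanSpace.single j (1 : ℝ) = WithLp.toLp 2 (j.insertNth (x + h) y) := by
    ext i
    obtain rfl | ⟨i, rfl⟩ := j.eq_self_or_eq_succAbove i <;> simp
  have hc : Continuous fun t : Fin (n + 1) → ℝ => H (WithLp.toLp 2 t) := by fun_prop
  have hc' : Continuous fun t : Fin (n + 1) → ℝ =>
    H (WithLp.toLp 2 t + h • EuclideanSpace.single j (1 : ℝ)) := by fun_prop
  rw [setIntegral_cube_eq, setIntegral_cube_eq,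
    setIntegral_pi_eq_succAbove j hc _ isCompact_Icc,
    setIntegral_pi_eq_succAbove j hc' _ isCompact_Icc]
  congr 1 with y
  simp only [hcomp]
  have hp : Function.Periodic (fun x => H (WithLp.toLp 2 (j.insertNth x y))) (2 * Real.pi) := by
    intro x
    simp only
    rw [← hper j (WithLp.toLp 2 (j.insertNth x y))]
    congr 1
    ext i
    obtain rfl | ⟨i, rfl⟩ := j.eq_self_or_eq_succAbove i <;> simp
  have := hp.intervalIntegral_add_eq h 0
  rw [integral_Icc_eq_integral_Ioc, integral_Icc_eq_integral_Ioc,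
    ← intervalIntegral.integral_of_le Real.two_pi_pos.le,
    ← intervalIntegral.integral_of_le Real.two_pi_pos.le,
    intervalIntegral.integral_comp_add_right (fun x => H (WithLp.toLp 2 (j.insertNth x y)))]
  simpa [add_comm] using this

/-! ### Characters, Fourier coefficients and Bessel's inequality -/

/-- The character `e^{-i(k,t)}`. -/
noncomputable def character (k : Fin m → ℤ) (t : EuclideanSpace ℝ (Fin m)) : ℂ :=
  Complex.exp (-Complex.I * ((∑ j, (k j : ℝ) * t j : ℝ) : ℂ))

theorem continuous_character (k : Fin m → ℤ) : Continuous (character k) := by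
  unfold character
  fun_prop

theorem norm_character (k : Fin m → ℤ) (t : EuclideanSpace ℝ (Fin m)) :
    ‖character k t‖ = 1 := by
  rw [character, neg_mul, mul_comm, ← neg_mul, ← Complex.ofReal_neg, Complex.norm_exp_ofReal_mul_I]

theorem character_add_smul_single (k : Fin m → ℤ) (t : EuclideanSpace ℝ (Fin m)) (j : Fin m)
    (h : ℝ) : character k (t + h • EuclideanSpace.single j (1 : ℝ)) =
      Complex.exp (-Complex.I * (k j * h)) * character k t := by
  rw [character, character, ← Complex.exp_add]
  congr 1
  have : ∑ i, (k i : ℝ) * (t + h • EuclideanSpace.single j (1 : ℝ)) i =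
      k j * h + ∑ i, (k i : ℝ) * t i := by
    simp [mul_add, Finset.sum_add_distrib, add_comm]
  rw [this]
  push_cast
  ring

theorem isPeriodic_character (k : Fin m → ℤ) : IsPeriodic (character k) := by
  intro j t
  have h := character_add_smul_single k t j (2 * Real.pi)
  have hs : (2 * Real.pi) • EuclideanSpace.single j (1 : ℝ) =
      EuclideanSpace.single j (2 * Real.pi) := by
    ext i
    simp
  rw [hs] at h
  rw [h, Complex.exp_eq_one_iff.2 ⟨-k j, by push_cast; ring⟩, one_mul]

theorem character_sub (k l : Fin m → ℤ) (t : EuclideanSpace ℝ (Fin m)) :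
    character (k - l) t = character k t * starRingEnd ℂ (character l t) := by
  simp only [character]
  rw [← Complex.exp_conj, ← Complex.exp_add]
  congr 1
  simp only [map_mul, map_neg, Complex.conj_I, Complex.conj_ofReal, Pi.sub_apply, Int.cast_sub,
    sub_mul, Finset.sum_sub_distrib, Complex.ofReal_sub]
  ring

/-- Translation by `π / k_j` along an axis with `k_j ≠ 0` changes the sign of the character but not
its integral. -/
theorem integral_character_eq_zero {k : Fin m → ℤ} (hk : k ≠ 0) :
    ∫ t in cube m, character k t = 0 := by
  obtain ⟨j, hj⟩ := Function.ne_iff.1 hk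
  have hj' : (k j : ℂ) ≠ 0 := by exact_mod_cast hj
  have h := setIntegral_cube_translate (continuous_character k) (isPeriodic_character k) j
    (Real.pi / k j)
  simp only [character_add_smul_single] at h
  have hexp : Complex.exp (-Complex.I * (k j * ((Real.pi / k j : ℝ) : ℂ))) = -1 := by
    push_cast
    rw [mul_div_cancel₀ _ hj', ← Complex.exp_neg_pi_mul_I]
    congr 1
    ring
  rw [hexp, integral_const_mul] at h
  have h2 : (2 : ℂ) * ∫ t in cube m, character k t = 0 := by linear_combination -h
  simpa using h2

theorem fourierCoef_eq (f : EuclideanSpace ℝ (Fin m) → ℂ) (k : Fin m → ℤ) :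
    fourierCoef f k = (1 / (2 * (Real.pi : ℂ)) ^ m) * ∫ t in cube m, f t * character k t := rfl

theorem IsPeriodic.mul {f g : EuclideanSpace ℝ (Fin m) → ℂ} (hf : IsPeriodic f)
    (hg : IsPeriodic g) : IsPeriodic fun t => f t * g t := fun j t => by
  simp only [hf j t, hg j t]

theorem fourierCoef_translate {F : EuclideanSpace ℝ (Fin m) → ℂ} (hF : Continuous F)
    (hper : IsPeriodic F) (j : Fin m) (h : ℝ) (k : Fin m → ℤ) :
    fourierCoef (fun t => F (t + h • EuclideanSpace.single j (1 : ℝ))) k =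
      Complex.exp (Complex.I * (k j * h)) * fourierCoef F k := by
  have hch := continuous_character k
  rw [fourierCoef_eq, fourierCoef_eq,
    ← setIntegral_cube_translate (H := fun t => F t * character k t) (by fun_prop)
      (hper.mul (isPeriodic_character k)) j h]
  simp only [character_add_smul_single]
  rw [mul_left_comm, ← integral_const_mul (Complex.exp (Complex.I * (k j * h)))]
  congr 1
  refine integral_congr_ae (Filter.Eventually.of_forall fun t => ?_)
  simp only
  have : Complex.exp (Complex.I * (k j * h)) * Complex.exp (-Complex.I * (k j * h)) = 1 := by
    rw [← Complex.exp_add]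
    simp
  linear_combination (-(F (t + h • EuclideanSpace.single j (1 : ℝ)) * character k t)) * this

theorem fourierCoef_sub {f g : EuclideanSpace ℝ (Fin m) → ℂ} (hf : Continuous f)
    (hg : Continuous g) (k : Fin m → ℤ) :
    fourierCoef (fun t => f t - g t) k = fourierCoef f k - fourierCoef g k := by
  have hch := continuous_character k
  simp only [fourierCoef_eq, sub_mul]
  rw [integral_sub (integrableOn_cube (by fun_prop)) (integrableOn_cube (by fun_prop)), mul_sub]

theorem fourierCoef_const_mul (c : ℂ) (f : EuclideanSpace ℝ (Fin m) → ℂ) (k : Fin m → ℤ) :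
    fourierCoef (fun t => c * f t) k = c * fourierCoef f k := by
  simp only [fourierCoef_eq, mul_assoc, integral_const_mul]
  ring

/-- Fourier coefficients of a directional derivative. -/
theorem fourierCoef_deriv {F G : EuclideanSpace ℝ (Fin m) → ℂ} (hF : Continuous F)
    (hG : Continuous G) (hper : IsPeriodic F) (j : Fin m) {C : ℝ} (hC : ∀ t, ‖G t‖ ≤ C)
    (hd : ∀ t x, HasDerivAt (fun x : ℝ => F (t + x • EuclideanSpace.single j (1 : ℝ)))
      (G (t + x • EuclideanSpace.single j (1 : ℝ))) x) (k : Fin m → ℤ) :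
    fourierCoef G k = Complex.I * k j * fourierCoef F k := by
  have : IsFiniteMeasure (volume.restrict (cube m)) :=
    isFiniteMeasure_restrict.2 (isCompact_cube m).measure_lt_top.ne
  have hch := continuous_character k
  -- Instead of integrating by parts, the coefficient of the translate of `F` by `x` is
  -- differentiated at `x = 0` in two ways: under the integral, and through its closed form `e^{i
  -- k_j x} F̂(k)`.
  have key := (hasDerivAt_integral_of_dominated_loc_of_deriv_le (𝕜 := ℝ)
    (μ := volume.restrict (cube m)) (x₀ := 0) (s := Set.univ) (bound := fun _ => C)
    (F := fun x t => F (t + x • EuclideanSpace.single j (1 : ℝ)) * character k t)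
    (F' := fun x t => G (t + x • EuclideanSpace.single j (1 : ℝ)) * character k t)
    Filter.univ_mem (Filter.Eventually.of_forall fun x => by
      refine Continuous.aestronglyMeasurable ?_; fun_prop)
    (integrableOn_cube (by fun_prop)) (by refine Continuous.aestronglyMeasurable ?_; fun_prop)
    (Filter.Eventually.of_forall fun t x _ => by
      rw [norm_mul, norm_character, mul_one]; exact hC _)
    (integrable_const C)
    (Filter.Eventually.of_forall fun t x _ => (hd t x).mul_const _)).2
  have h1 := key.const_mul (1 / (2 * (Real.pi : ℂ)) ^ m)
  have h2 : (fun x : ℝ => (1 / (2 * (Real.pi : ℂ)) ^ m) *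
      ∫ t in cube m, F (t + x • EuclideanSpace.single j (1 : ℝ)) * character k t) =
      fun x : ℝ => Complex.exp (Complex.I * (k j * x)) * fourierCoef F k := by
    ext x
    rw [← fourierCoef_translate hF hper, fourierCoef_eq]
  rw [h2] at h1
  have h3 : HasDerivAt (fun x : ℝ => Complex.exp (Complex.I * (k j * x)) * fourierCoef F k)
      (Complex.I * k j * fourierCoef F k) 0 := by
    have h4 : HasDerivAt (fun x : ℝ => Complex.I * ((k j : ℂ) * (x : ℂ))) (Complex.I * k j) 0 := by
      have h5 := ((hasDerivAt_id (0 : ℝ)).ofReal_comp.const_mul (k j : ℂ)).const_mul Complex.I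
      simpa using h5
    have h6 := h4.cexp.mul_const (fourierCoef F k)
    simpa using h6
  have h7 := h1.unique h3
  simpa [fourierCoef_eq] using h7

/-- Bessel's inequality for bounded continuous functions. -/
theorem sum_norm_fourierCoef_sq_le {F : EuclideanSpace ℝ (Fin m) → ℂ} (hF : Continuous F)
    {C : ℝ} (hC : ∀ t, ‖F t‖ ≤ C) (S : Finset (Fin m → ℤ)) :
    ∑ k ∈ S, ‖fourierCoef F k‖ ^ 2 ≤ C ^ 2 := by
  have : IsFiniteMeasure (volume.restrict (cube m)) :=
    isFiniteMeasure_restrict.2 (isCompact_cube m).measure_lt_top.ne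
  set μ := volume.restrict (cube m) with hμ
  have hV : 0 < (2 * Real.pi) ^ m := pow_pos Real.two_pi_pos m
  set V : ℝ := (2 * Real.pi) ^ m with hVdef
  have hμV : μ.real Set.univ = V := by
    simp [hμ, measureReal_def, ← volume_real_cube, V]
  -- With `c = V^{-1/2}` the functions `c e^{i(k,t)}` are orthonormal in `L²` of the cube, and the
  -- inner products with `F` are `c⁻¹ F̂(k)`.
  set c : ℂ := (((Real.sqrt V)⁻¹ : ℝ) : ℂ) with hc
  have hcc : c * c = 1 / (2 * (Real.pi : ℂ)) ^ m := by
    rw [hc, ← Complex.ofReal_mul, ← mul_inv, Real.mul_self_sqrt hV.le, hVdef]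
    push_cast
    rw [one_div]
  have hcV : c * c * V = 1 := by
    rw [hc, ← Complex.ofReal_mul, ← mul_inv, Real.mul_self_sqrt hV.le, ← Complex.ofReal_mul,
      inv_mul_cancel₀ hV.ne', Complex.ofReal_one]
  have hmem {G : EuclideanSpace ℝ (Fin m) → ℂ} (hG : Continuous G) {D : ℝ}
      (hD : ∀ t, ‖G t‖ ≤ D) : MemLp G 2 μ :=
    MemLp.of_bound hG.aestronglyMeasurable D (Filter.Eventually.of_forall hD)
  have hv (k : Fin m → ℤ) : MemLp (fun t => c * starRingEnd ℂ (character k t)) 2 μ := by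
    have := continuous_character k
    refine hmem (D := ‖c‖) (by fun_prop) fun t => ?_
    simp [norm_character]
  have hinner {G H : EuclideanSpace ℝ (Fin m) → ℂ} (hG : MemLp G 2 μ) (hH : MemLp H 2 μ) :
      inner ℂ (hG.toLp G) (hH.toLp H) = ∫ t, H t * starRingEnd ℂ (G t) ∂μ := by
    rw [L2.inner_def]
    refine integral_congr_ae ?_
    filter_upwards [hG.coeFn_toLp, hH.coeFn_toLp] with t h1 h2
    rw [h1, h2]
    rfl
  have hconj : starRingEnd ℂ c = c := Complex.conj_ofReal _
  have horth : Orthonormal ℂ fun k => (hv k).toLp _ := by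
    rw [orthonormal_iff_ite]
    intro k l
    rw [hinner]
    have : ∀ t, c * starRingEnd ℂ (character l t) *
        starRingEnd ℂ (c * starRingEnd ℂ (character k t)) = c * c * character (k - l) t := by
      intro t
      rw [character_sub, map_mul, hconj, Complex.conj_conj]
      ring
    simp only [this]
    rw [integral_const_mul]
    split_ifs with hkl
    · subst hkl
      have h1 : ∀ t : EuclideanSpace ℝ (Fin m), character (k - k) t = 1 := by
        intro t
        simp [character]
      simp only [h1]
      rw [integral_const, hμV]
      simpa using hcV
    · rw [integral_character_eq_zero (sub_ne_zero.2 hkl), mul_zero]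
  have hFm := hmem hF hC
  have hb := horth.sum_inner_products_le (hFm.toLp F) (s := S)
  have hnorm : ‖hFm.toLp F‖ ^ 2 ≤ C ^ 2 * V := by
    have h1 : ((‖hFm.toLp F‖ ^ 2 : ℝ) : ℂ) = ∫ t, F t * starRingEnd ℂ (F t) ∂μ := by
      rw [← hinner hFm hFm, inner_self_eq_norm_sq_to_K]
      push_cast
      rfl
    have h2 : ‖∫ t, F t * starRingEnd ℂ (F t) ∂μ‖ ≤ C ^ 2 * μ.real Set.univ := by
      refine norm_integral_le_of_norm_le_const (Filter.Eventually.of_forall fun t => ?_)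
      rw [norm_mul, RCLike.norm_conj, ← sq]
      exact pow_le_pow_left₀ (norm_nonneg _) (hC t) 2
    rw [← h1, hμV, Complex.norm_real, Real.norm_of_nonneg (sq_nonneg _)] at h2
    exact h2
  have hco (k : Fin m → ℤ) :
      inner ℂ ((hv k).toLp _) (hFm.toLp F) = c⁻¹ * fourierCoef F k := by
    have hc0 : c ≠ 0 := by
      intro h
      simp [h] at hcV
    rw [hinner, fourierCoef_eq, ← hcc, ← mul_assoc, inv_mul_cancel_left₀ hc0,
      ← integral_const_mul]
    congr 1 with t
    rw [map_mul, hconj, Complex.conj_conj]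
    ring
  have hcn : ‖c⁻¹‖ ^ 2 = V := by
    rw [hc, norm_inv, Complex.norm_real, norm_inv, inv_inv, Real.norm_of_nonneg (Real.sqrt_nonneg _),
      Real.sq_sqrt hV.le]
  simp only [hco, norm_mul, mul_pow, hcn] at hb
  rw [← Finset.mul_sum] at hb
  nlinarith [hb.trans hnorm]

/-! ### Boundedness of continuous periodic functions -/

theorem IsPeriodic.exists_mem_cube_eq {Y : Type*} {f : EuclideanSpace ℝ (Fin m) → Y}
    (hf : IsPeriodic f) (t : EuclideanSpace ℝ (Fin m)) : ∃ s ∈ cube m, f s = f t := by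
  have hp : Function.Periodic f
      (∑ j, (-⌊t j / (2 * Real.pi)⌋) • EuclideanSpace.single j (2 * Real.pi)) :=
    Finset.sum_induction _ (Function.Periodic f) (fun a b ha hb => ha.add_period hb)
      (fun x => by rw [add_zero]) fun j _ => Function.Periodic.zsmul (hf j) _
  refine ⟨_, fun j => ?_, hp t⟩
  have h0 := Real.two_pi_pos
  have h1 := Int.floor_le (t j / (2 * Real.pi))
  have h2 := Int.lt_floor_add_one (t j / (2 * Real.pi))
  rw [le_div_iff₀ h0] at h1
  rw [div_lt_iff₀ h0] at h2
  have h3 : (t + ∑ i, (-⌊t i / (2 * Real.pi)⌋) • EuclideanSpace.single i (2 * Real.pi)) j =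
      t j - ⌊t j / (2 * Real.pi)⌋ * (2 * Real.pi) := by
    simp [Pi.single_apply, sub_eq_add_neg]
  rw [h3]
  constructor <;> linarith

theorem IsPeriodic.exists_norm_le {f : EuclideanSpace ℝ (Fin m) → ℝ} (hper : IsPeriodic f)
    (hf : Continuous f) : ∃ C, ∀ t, ‖f t‖ ≤ C := by
  obtain ⟨C, hC⟩ := (isCompact_cube m).exists_bound_of_continuousOn hf.continuousOn
  refine ⟨C, fun t => ?_⟩
  obtain ⟨s, hs, hst⟩ := hper.exists_mem_cube_eq t
  rw [← hst]
  exact hC s hs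

/-! ### Families of functions smooth at the scale `1/l` -/

/-- A family of continuous functions on the torus, bounded uniformly in the parameter `l ≥ 1`. -/
def BoundedFamily (F : ℝ → EuclideanSpace ℝ (Fin m) → ℂ) : Prop :=
  (∀ l, 1 ≤ l → Continuous (F l) ∧ IsPeriodic (F l)) ∧ ∃ C, ∀ l, 1 ≤ l → ∀ t, ‖F l t‖ ≤ C

/-- Families with `r` derivatives along the `j`-th coordinate axis, bounded in terms of the scaled
derivation `l⁻¹ ∂_j`, the last of which is Lipschitz of order `α` at the scale `l⁻¹`. -/
def SmoothFamily (j : Fin m) (α : ℝ) : ℕ → (ℝ → EuclideanSpace ℝ (Fin m) → ℂ) → Prop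
  | 0, F => BoundedFamily F ∧ ∃ C, ∀ l, 1 ≤ l → ∀ h, 0 < h → l * h ≤ 1 → ∀ t,
      ‖F l (t + h • EuclideanSpace.single j (1 : ℝ)) - F l t‖ ≤ C * (l * h) ^ α
  | r + 1, F => BoundedFamily F ∧ ∃ G : ℝ → EuclideanSpace ℝ (Fin m) → ℂ,
      (∀ l, 1 ≤ l → ∀ t, ∀ x : ℝ,
        HasDerivAt (fun x : ℝ => F l (t + x • EuclideanSpace.single j (1 : ℝ)))
          (l * G l (t + x • EuclideanSpace.single j (1 : ℝ))) x) ∧ SmoothFamily j α r G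

namespace SmoothFamily

variable {j : Fin m} {α : ℝ} {r : ℕ} {F G : ℝ → EuclideanSpace ℝ (Fin m) → ℂ}

theorem boundedFamily (hF : SmoothFamily j α r F) : BoundedFamily F := by
  cases r <;> exact hF.1

/-- Mean value inequality: the derivative is bounded by a multiple of `l`. -/
theorem zero_of_one (hF : SmoothFamily j α 1 F) : SmoothFamily j 1 0 F := by
  obtain ⟨hb, G, hG, hG0⟩ := hF
  obtain ⟨C, hC⟩ := hG0.boundedFamily.2
  refine ⟨hb, C, fun l hl h hh _ t => ?_⟩
  have h1 := (convex_univ : Convex ℝ (Set.univ : Set ℝ)).norm_image_sub_le_of_norm_hasDerivWithin_le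
    (C := l * C) (x := 0) (y := h) (fun x _ => (hG l hl t x).hasDerivWithinAt) (fun x _ => by
      rw [norm_mul, Complex.norm_real, Real.norm_of_nonneg (by linarith)]
      exact mul_le_mul_of_nonneg_left (hC l hl _) (by linarith)) trivial trivial
  simp only [zero_smul, add_zero, sub_zero, Real.norm_of_nonneg hh.le] at h1
  rw [Real.rpow_one]
  linarith

/-- The restriction `l * h ≤ 1` in the definition gives `l * h ≤ (l * h) ^ α`. -/
theorem mono_order (hα : α ≤ 1) (hF : SmoothFamily j 1 0 F) :
    SmoothFamily j α 0 F := by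
  obtain ⟨hb, C, hC⟩ := hF
  refine ⟨hb, |C|, fun l hl h hh hlh t => (hC l hl h hh hlh t).trans ?_⟩
  have hpos : 0 < l * h := by positivity
  exact mul_le_mul (le_abs_self C) (Real.rpow_le_rpow_of_exponent_ge hpos hlh hα)
    (by positivity) (abs_nonneg C)

theorem of_succ (hα : α ≤ 1) (hF : SmoothFamily j α (r + 1) F) : SmoothFamily j α r F := by
  induction r generalizing F with
  | zero => exact hF.zero_of_one.mono_order hα
  | succ r ih =>
    obtain ⟨hb, G, hG, hGr⟩ := hF
    exact ⟨hb, G, hG, ih hGr⟩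

theorem of_le (hα : α ≤ 1) {s : ℕ} (hrs : r ≤ s) (hF : SmoothFamily j α s F) :
    SmoothFamily j α r F := by
  induction s, hrs using Nat.le_induction with
  | base => exact hF
  | succ s _ ih => exact ih (hF.of_succ hα)

end SmoothFamily

theorem BoundedFamily.add {F G : ℝ → EuclideanSpace ℝ (Fin m) → ℂ} (hF : BoundedFamily F)
    (hG : BoundedFamily G) : BoundedFamily fun l t => F l t + G l t := by
  obtain ⟨hF, C, hC⟩ := hF
  obtain ⟨hG, D, hD⟩ := hG
  exact ⟨fun l hl => ⟨(hF l hl).1.add (hG l hl).1, fun i t => by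
    simp only [(hF l hl).2 i t, (hG l hl).2 i t]⟩, C + D, fun l hl t =>
    (norm_add_le _ _).trans (add_le_add (hC l hl t) (hD l hl t))⟩

theorem BoundedFamily.mul {F G : ℝ → EuclideanSpace ℝ (Fin m) → ℂ} (hF : BoundedFamily F)
    (hG : BoundedFamily G) : BoundedFamily fun l t => F l t * G l t := by
  obtain ⟨hF, C, hC⟩ := hF
  obtain ⟨hG, D, hD⟩ := hG
  exact ⟨fun l hl => ⟨(hF l hl).1.mul (hG l hl).1, (hF l hl).2.mul (hG l hl).2⟩, C * D,
    fun l hl t => by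
      rw [norm_mul]
      exact mul_le_mul (hC l hl t) (hD l hl t) (norm_nonneg _) ((norm_nonneg _).trans (hC l hl t))⟩

namespace SmoothFamily

variable {j : Fin m} {α : ℝ} {r : ℕ} {F G : ℝ → EuclideanSpace ℝ (Fin m) → ℂ}

theorem add (hF : SmoothFamily j α r F) (hG : SmoothFamily j α r G) :
    SmoothFamily j α r fun l t => F l t + G l t := by
  induction r generalizing F G with
  | zero =>
    refine ⟨hF.1.add hG.1, ?_⟩
    obtain ⟨-, C, hC⟩ := hF
    obtain ⟨-, D, hD⟩ := hG
    refine ⟨C + D, fun l hl h hh hlh t => ?_⟩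
    rw [add_sub_add_comm, add_mul]
    exact (norm_add_le _ _).trans (add_le_add (hC l hl h hh hlh t) (hD l hl h hh hlh t))
  | succ r ih =>
    refine ⟨hF.1.add hG.1, ?_⟩
    obtain ⟨-, F', hF', hFr⟩ := hF
    obtain ⟨-, G', hG', hGr⟩ := hG
    refine ⟨_, fun l hl t x => ?_, ih hFr hGr⟩
    rw [mul_add]
    exact (hF' l hl t x).add (hG' l hl t x)

theorem mul (hα : α ≤ 1) (hF : SmoothFamily j α r F) (hG : SmoothFamily j α r G) :
    SmoothFamily j α r fun l t => F l t * G l t := by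
  induction r generalizing F G with
  | zero =>
    refine ⟨hF.1.mul hG.1, ?_⟩
    obtain ⟨⟨-, A, hA⟩, C, hC⟩ := hF
    obtain ⟨⟨-, B, hB⟩, D, hD⟩ := hG
    refine ⟨A * D + C * B, fun l hl h hh hlh t => ?_⟩
    set s := t + h • EuclideanSpace.single j (1 : ℝ)
    have h1 : F l s * G l s - F l t * G l t = F l s * (G l s - G l t) + (F l s - F l t) * G l t := by
      ring
    have hA0 := (norm_nonneg _).trans (hA l hl s)
    have hC0 := (norm_nonneg _).trans (hC l hl h hh hlh t)
    rw [h1, add_mul, mul_assoc, mul_right_comm]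
    refine (norm_add_le _ _).trans (add_le_add ?_ ?_)
    · rw [norm_mul]
      exact mul_le_mul (hA l hl s) (hD l hl h hh hlh t) (norm_nonneg _) hA0
    · rw [norm_mul]
      exact mul_le_mul (hC l hl h hh hlh t) (hB l hl t) (norm_nonneg _) hC0
  | succ r ih =>
    refine ⟨hF.1.mul hG.1, ?_⟩
    -- In the Leibniz rule the undifferentiated factors are needed with only `r` derivatives.
    have hF0 := hF.of_succ hα
    have hG0 := hG.of_succ hα
    obtain ⟨-, F', hF', hFr⟩ := hF
    obtain ⟨-, G', hG', hGr⟩ := hG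
    refine ⟨_, fun l hl t x => ?_, (ih hFr hG0).add (ih hF0 hGr)⟩
    refine ((hF' l hl t x).mul (hG' l hl t x)).congr_deriv ?_
    ring

/-- The constant may depend on `l`, so that factors such as `l⁻¹` are covered. -/
theorem const {c : ℝ → ℂ} {C : ℝ} (hc : ∀ l, 1 ≤ l → ‖c l‖ ≤ C) :
    SmoothFamily j α r fun l _ => c l := by
  induction r generalizing c C with
  | zero =>
    exact ⟨⟨fun l _ => ⟨continuous_const, fun _ _ => rfl⟩, C, fun l hl _ => hc l hl⟩, 0,
      fun l _ h _ _ t => by simp⟩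
  | succ r ih =>
    refine ⟨⟨fun l _ => ⟨continuous_const, fun _ _ => rfl⟩, C, fun l hl _ => hc l hl⟩,
      fun _ _ => 0, fun l _ t x => ?_, ih (c := fun _ => 0) (C := 0) (by simp)⟩
    simpa using hasDerivAt_const x (c l)

/-- Quadratic decay of the Fourier coefficients on the slabs `T ≤ |k_j| ≤ 2T`, `T ≥ l`. -/
theorem exists_sum_sq_le (hF : SmoothFamily j α r F) : ∃ C, ∀ l, 1 ≤ l → ∀ T, l ≤ T →
    ∀ S : Finset (Fin m → ℤ), (∀ k ∈ S, T ≤ |(k j : ℝ)| ∧ |(k j : ℝ)| ≤ 2 * T) →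
      ∑ k ∈ S, ‖fourierCoef (F l) k‖ ^ 2 ≤ C * ((l / T) ^ ((r : ℝ) + α)) ^ 2 := by
  induction r generalizing F with
  | zero =>
    obtain ⟨⟨hcont, -⟩, C, hC⟩ := hF
    refine ⟨4 * C ^ 2, fun l hl T hT S hS => ?_⟩
    have hT0 : 0 < T := by linarith
    obtain ⟨hc, hper⟩ := hcont l hl
    -- The step `T⁻¹` is matched to the slab: there the multiplier `e^{i k_j / T} - 1` has phase
    -- between `1` and `2` in absolute value, hence modulus at least `1/2`. This is the source of
    -- the constant `4`.
    set D : EuclideanSpace ℝ (Fin m) → ℂ := fun t =>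
      F l (t + T⁻¹ • EuclideanSpace.single j (1 : ℝ)) - F l t with hD
    have hDC : Continuous D := by fun_prop
    have hB := sum_norm_fourierCoef_sq_le hDC (C := C * (l / T) ^ α)
      (hC l hl T⁻¹ (by positivity) (by rw [← div_eq_mul_inv]; exact (div_le_one hT0).2 hT)) S
    have hk : ∀ k ∈ S, ‖fourierCoef (F l) k‖ ^ 2 ≤ 4 * ‖fourierCoef D k‖ ^ 2 := by
      intro k hk
      obtain ⟨h1, h2⟩ := hS k hk
      have h3 : fourierCoef D k =
          (Complex.exp (Complex.I * ((k j * T⁻¹ : ℝ) : ℂ)) - 1) * fourierCoef (F l) k := by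
        rw [hD, fourierCoef_sub (by fun_prop) hc, fourierCoef_translate hc hper]
        push_cast
        ring
      -- For the phase `θ`, `|e^{iθ} - 1| = 2|sin(θ/2)| ≥ (2/π)|θ| ≥ 1/2` by Jordan's inequality.
      have h4 : 1 / 2 ≤ ‖Complex.exp (Complex.I * ((k j * T⁻¹ : ℝ) : ℂ)) - 1‖ := by
        have h5 : |(k j : ℝ) * T⁻¹| = |(k j : ℝ)| / T := by
          rw [abs_mul, abs_inv, abs_of_pos hT0, div_eq_mul_inv]
        have h6 : 1 ≤ |(k j : ℝ) * T⁻¹| := by rwa [h5, one_le_div hT0]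
        have h7 : |(k j : ℝ) * T⁻¹| ≤ 2 := by rwa [h5, div_le_iff₀ hT0]
        have h8 : |(k j : ℝ) * T⁻¹ / 2| = |(k j : ℝ) * T⁻¹| / 2 := by
          rw [abs_div, abs_two]
        have h9 := Real.mul_abs_le_abs_sin (x := (k j : ℝ) * T⁻¹ / 2)
          (by rw [h8]; linarith [Real.pi_gt_three])
        rw [Complex.norm_exp_I_mul_ofReal_sub_one, norm_mul, Real.norm_eq_abs, Real.norm_eq_abs,
          abs_two]
        have h10 : 1 / 2 ≤ 2 / Real.pi := by
          rw [div_le_div_iff₀ two_pos Real.pi_pos]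
          linarith [Real.pi_le_four]
        rw [h8] at h9
        nlinarith
      rw [h3, norm_mul, mul_pow]
      have : (1 / 2 : ℝ) ^ 2 ≤ ‖Complex.exp (Complex.I * ((k j * T⁻¹ : ℝ) : ℂ)) - 1‖ ^ 2 :=
        pow_le_pow_left₀ (by norm_num) h4 2
      nlinarith [sq_nonneg ‖fourierCoef (F l) k‖]
    calc _ ≤ ∑ k ∈ S, 4 * ‖fourierCoef D k‖ ^ 2 := Finset.sum_le_sum hk
      _ = 4 * ∑ k ∈ S, ‖fourierCoef D k‖ ^ 2 := by rw [Finset.mul_sum]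
      _ ≤ 4 * (C * (l / T) ^ α) ^ 2 := by gcongr
      _ = _ := by
        push_cast
        rw [zero_add]
        ring
  | succ r ih =>
    obtain ⟨⟨hcont, -⟩, G, hd, hG⟩ := hF
    obtain ⟨C, hC⟩ := ih hG
    obtain ⟨hGc, B, hB⟩ := hG.boundedFamily
    refine ⟨C, fun l hl T hT S hS => ?_⟩
    have hT0 : 0 < T := by linarith
    have hl0 : 0 < l := by linarith
    have hlT : 0 < l / T := by positivity
    obtain ⟨hc, hper⟩ := hcont l hl
    have hGl := (hGc l hl).1
    -- Since `l Ĝ(k) = i k_j F̂(k)` and `|k_j| ≥ T`, each derivative gains a factor `l / T`.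
    have hk : ∀ k ∈ S, ‖fourierCoef (F l) k‖ ^ 2 ≤ (l / T) ^ 2 * ‖fourierCoef (G l) k‖ ^ 2 := by
      intro k hk
      have h1 := fourierCoef_deriv (G := fun t => l * G l t) hc (by fun_prop) hper j (C := l * B)
        (fun t => by
          rw [norm_mul, Complex.norm_real, Real.norm_of_nonneg hl0.le]
          exact mul_le_mul_of_nonneg_left (hB l hl t) hl0.le) (hd l hl) k
      rw [fourierCoef_const_mul] at h1
      have h2 := congrArg norm h1
      rw [norm_mul, norm_mul, norm_mul, Complex.norm_I, Complex.norm_real, one_mul,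
        Real.norm_of_nonneg hl0.le, Complex.norm_intCast] at h2
      rw [← mul_pow]
      refine pow_le_pow_left₀ (norm_nonneg _) ?_ 2
      rw [div_mul_eq_mul_div, h2, le_div_iff₀ hT0, mul_comm]
      exact mul_le_mul_of_nonneg_right (hS k hk).1 (norm_nonneg _)
    calc _ ≤ ∑ k ∈ S, (l / T) ^ 2 * ‖fourierCoef (G l) k‖ ^ 2 := Finset.sum_le_sum hk
      _ = (l / T) ^ 2 * ∑ k ∈ S, ‖fourierCoef (G l) k‖ ^ 2 := by rw [Finset.mul_sum]
      _ ≤ (l / T) ^ 2 * (C * ((l / T) ^ ((r : ℝ) + α)) ^ 2) := by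
        gcongr
        exact hC l hl T hT S hS
      _ = _ := by
        have : ((r + 1 : ℕ) : ℝ) + α = ((r : ℝ) + α) + 1 := by
          push_cast
          ring
        rw [this, Real.rpow_add_one hlT.ne']
        ring

end SmoothFamily

/-! ### Regularity of the phase and of its exponential -/

theorem IsPeriodic.iteratedFDeriv_apply {φ : EuclideanSpace ℝ (Fin m) → ℝ} (hφ : IsPeriodic φ)
    (n : ℕ) (v : Fin n → EuclideanSpace ℝ (Fin m)) :
    IsPeriodic fun t => iteratedFDeriv ℝ n φ t v := by
  intro i t
  have h : (fun z => φ (z + EuclideanSpace.single i (2 * Real.pi))) = φ := funext (hφ i)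
  simp only
  rw [← iteratedFDeriv_comp_add_right, h]

/-- Beyond the threshold `δ` boundedness suffices: the variation is at most `2B ≤ 2B (h/δ)^α`. -/
theorem LipOrder.exists_bound {α : ℝ} {g : EuclideanSpace ℝ (Fin m) → ℝ} (hα : 0 ≤ α)
    (hg : LipOrder α g) {B : ℝ} (hB : ∀ t, ‖g t‖ ≤ B) :
    ∃ C, 0 ≤ C ∧ ∀ h, 0 < h → ∀ s t, ‖s - t‖ ≤ h → |g s - g t| ≤ C * h ^ α := by
  obtain ⟨C, δ, hδ, hC⟩ := hg
  have hB0 : 0 ≤ B := (norm_nonneg _).trans (hB 0)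
  refine ⟨max C (2 * B / δ ^ α), le_max_of_le_right (by positivity), fun h hh s t hst => ?_⟩
  rcases le_total h δ with hle | hle
  · exact (hC h hh hle s t hst).trans (by gcongr; exact le_max_left _ _)
  · have h1 : |g s - g t| ≤ 2 * B := by
      have := norm_sub_le (g s) (g t)
      rw [Real.norm_eq_abs] at this
      linarith [hB s, hB t]
    calc |g s - g t| ≤ 2 * B := h1
      _ = 2 * B / δ ^ α * δ ^ α := by field_simp
      _ ≤ 2 * B / δ ^ α * h ^ α := by gcongr
      _ ≤ _ := by gcongr; exact le_max_right _ _

theorem hasDerivAt_iteratedFDeriv_line {φ : EuclideanSpace ℝ (Fin m) → ℝ} {ν n : ℕ}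
    (hφ : ContDiff ℝ ν φ) (hn : (n : WithTop ℕ∞) < ν) (e t : EuclideanSpace ℝ (Fin m)) (x : ℝ) :
    HasDerivAt (fun x : ℝ => iteratedFDeriv ℝ n φ (t + x • e) fun _ => e)
      (iteratedFDeriv ℝ (n + 1) φ (t + x • e) fun _ => e) x := by
  have hd : HasFDerivAt (iteratedFDeriv ℝ n φ) (fderiv ℝ (iteratedFDeriv ℝ n φ) (t + x • e))
      (t + x • e) := (hφ.differentiable_iteratedFDeriv hn _).hasFDerivAt
  have hline : HasDerivAt (fun x : ℝ => t + x • e) e x := by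
    simpa using ((hasDerivAt_id x).smul_const e).const_add t
  have h2 := (ContinuousMultilinearMap.apply ℝ (fun _ : Fin n => EuclideanSpace ℝ (Fin m)) ℝ
    fun _ => e).hasFDerivAt.comp_hasDerivAt x (hd.comp_hasDerivAt x hline)
  rw [iteratedFDeriv_succ_apply_left]
  exact h2

theorem boundedFamily_iteratedFDeriv {φ : EuclideanSpace ℝ (Fin m) → ℝ} {ν n : ℕ}
    (hper : IsPeriodic φ) (hφ : ContDiff ℝ ν φ) (hn : n ≤ ν) (e : EuclideanSpace ℝ (Fin m)) :
    BoundedFamily fun _ t => ((iteratedFDeriv ℝ n φ t fun _ => e : ℝ) : ℂ) := by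
  have hcont : Continuous fun t => iteratedFDeriv ℝ n φ t fun _ => e :=
    (ContinuousMultilinearMap.apply ℝ (fun _ : Fin n => EuclideanSpace ℝ (Fin m)) ℝ
      fun _ => e).continuous.comp (hφ.continuous_iteratedFDeriv (by exact_mod_cast hn))
  have hp := hper.iteratedFDeriv_apply n fun _ => e
  obtain ⟨B, hB⟩ := hp.exists_norm_le hcont
  exact ⟨fun l _ => ⟨Complex.continuous_ofReal.comp hcont, fun i t => by simp only [hp i t]⟩, B,
    fun l _ t => by rw [Complex.norm_real]; exact hB t⟩

theorem MemC.smoothFamily_iteratedFDeriv {ν : ℕ} {α : ℝ} (hα0 : 0 ≤ α) (hα1 : α ≤ 1)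
    {φ : EuclideanSpace ℝ (Fin m) → ℝ} (hφ : MemC ν α φ) (j : Fin m) (r n : ℕ) (hrn : r + n = ν) :
    SmoothFamily j α r fun _ t =>
      ((iteratedFDeriv ℝ n φ t fun _ => EuclideanSpace.single j (1 : ℝ) : ℝ) : ℂ) := by
  obtain ⟨hper, hsm, hlip⟩ := hφ
  induction r generalizing n with
  | zero =>
    obtain rfl : n = ν := by omega
    have hbdd := boundedFamily_iteratedFDeriv hper hsm le_rfl (EuclideanSpace.single j (1 : ℝ))
    obtain ⟨B, hB⟩ := hbdd.2
    replace hB := hB 1 le_rfl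
    simp only [Complex.norm_real] at hB
    refine ⟨hbdd, ?_⟩
    rcases hα0.eq_or_lt with rfl | hpos
    · refine ⟨2 * B, fun l hl h hh _ t => ?_⟩
      rw [Real.rpow_zero, mul_one, ← Complex.ofReal_sub, Complex.norm_real]
      have h1 := hB (t + h • EuclideanSpace.single j (1 : ℝ))
      have h2 := hB t
      exact (norm_sub_le _ _).trans (by linarith)
    · obtain ⟨C, hC0, hC⟩ := (hlip hpos fun _ => j).exists_bound hα0 hB
      refine ⟨C, fun l hl h hh _ t => ?_⟩
      rw [← Complex.ofReal_sub, Complex.norm_real]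
      refine (hC h hh (t + h • EuclideanSpace.single j (1 : ℝ)) t ?_).trans ?_
      · simp [norm_smul, abs_of_pos hh]
      · gcongr
        exact le_mul_of_one_le_left hh.le hl
  | succ r ih =>
    have hlt : (n : WithTop ℕ∞) < ν := by exact_mod_cast (by omega : n < ν)
    -- The phase does not depend on `l`, so its scaled derivative is `l⁻¹ ∂_j`, with a harmless
    -- factor `l⁻¹ ≤ 1`.
    have hinv : SmoothFamily j α r fun (l : ℝ) (_ : EuclideanSpace ℝ (Fin m)) => ((l⁻¹ : ℝ) : ℂ) :=
      SmoothFamily.const (C := 1) fun l hl => by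
        rw [Complex.norm_real, norm_inv, Real.norm_of_nonneg (by linarith)]
        exact inv_le_one_of_one_le₀ hl
    refine ⟨boundedFamily_iteratedFDeriv hper hsm (by omega) _, _, fun l hl t x => ?_,
      hinv.mul hα1 (ih (n + 1) (by omega))⟩
    have hl0 : (l : ℂ) ≠ 0 := by exact_mod_cast (by linarith : l ≠ 0)
    push_cast
    rw [mul_inv_cancel_left₀ hl0]
    exact (hasDerivAt_iteratedFDeriv_line hsm hlt _ t x).ofReal_comp

/-- The exponential `u` satisfies `l⁻¹ ∂_j u = i c (∂_j φ) u`, so if `u` has `r < ν` scaled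
derivatives, the right side does too and `u` has `r + 1`. The base case uses that `φ` is Lipschitz,
which is what `1 ≤ ν + α` provides. -/
theorem MemC.smoothFamily_exp {ν : ℕ} {α : ℝ} (hα0 : 0 ≤ α) (hα1 : α ≤ 1)
    (h1 : 1 ≤ (ν : ℝ) + α) {φ : EuclideanSpace ℝ (Fin m) → ℝ} (hφ : MemC ν α φ) (j : Fin m)
    (c : ℝ) :
    SmoothFamily j α ν fun l t => Complex.exp (Complex.I * ((c * l * φ t : ℝ) : ℂ)) := by
  have hφc : Continuous φ := hφ.2.1.continuous
  have hbdd : BoundedFamily fun l t => Complex.exp (Complex.I * ((c * l * φ t : ℝ) : ℂ)) :=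
    ⟨fun l _ => ⟨by fun_prop, fun i t => by simp only [hφ.1 i t]⟩, 1, fun l _ t => by
      simp only
      rw [mul_comm, Complex.norm_exp_ofReal_mul_I]⟩
  have hφ0 : SmoothFamily j α ν fun _ t => (φ t : ℂ) := by
    simpa using hφ.smoothFamily_iteratedFDeriv hα0 hα1 j ν 0 rfl
  have hφL : SmoothFamily j 1 0 fun _ t => (φ t : ℂ) := by
    rcases Nat.eq_zero_or_pos ν with rfl | hν
    · obtain rfl : α = 1 := le_antisymm hα1 (by simpa using h1)
      exact hφ0
    · exact (hφ0.of_le hα1 hν).zero_of_one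
  suffices H : ∀ r ≤ ν, SmoothFamily j α r fun l t =>
    Complex.exp (Complex.I * ((c * l * φ t : ℝ) : ℂ)) from H ν le_rfl
  intro r
  induction r with
  | zero =>
    intro _
    refine SmoothFamily.mono_order hα1 ⟨hbdd, ?_⟩
    obtain ⟨-, C, hC⟩ := hφL
    refine ⟨|c| * C, fun l hl h hh hlh t => ?_⟩
    set s := t + h • EuclideanSpace.single j (1 : ℝ)
    -- The phase is estimated at parameter `1`, so the only factor `l` is the one in the exponent.
    have h2 := hC 1 le_rfl h hh (by nlinarith) t
    rw [← Complex.ofReal_sub, Complex.norm_real, one_mul, Real.rpow_one] at h2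
    have h3 : Complex.exp (Complex.I * ((c * l * φ s : ℝ) : ℂ)) -
        Complex.exp (Complex.I * ((c * l * φ t : ℝ) : ℂ)) =
        Complex.exp (Complex.I * ((c * l * φ t : ℝ) : ℂ)) *
          (Complex.exp (Complex.I * ((c * l * (φ s - φ t) : ℝ) : ℂ)) - 1) := by
      rw [mul_sub, ← Complex.exp_add, mul_one]
      congr 2
      push_cast
      ring
    rw [h3, norm_mul, mul_comm Complex.I, Complex.norm_exp_ofReal_mul_I, one_mul, Real.rpow_one]
    refine (Real.norm_exp_I_mul_ofReal_sub_one_le).trans ?_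
    rw [norm_mul, norm_mul, Real.norm_eq_abs c, Real.norm_of_nonneg (by linarith : 0 ≤ l)]
    have : |c| * l * ‖φ s - φ t‖ ≤ |c| * l * (C * h) := by gcongr
    linarith
  | succ r ih =>
    intro hr
    have hf := ih (by omega)
    have hφ' := (hφ.smoothFamily_iteratedFDeriv hα0 hα1 j (ν - 1) 1 (by omega)).of_le hα1
      (by omega : r ≤ ν - 1)
    have hc : SmoothFamily j α r fun (_ : ℝ) (_ : EuclideanSpace ℝ (Fin m)) => Complex.I * c :=
      SmoothFamily.const (C := |c|) fun _ _ => by simp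
    refine ⟨hbdd, _, fun l hl t x => ?_, (hc.mul hα1 hφ').mul hα1 hf⟩
    have hlt : ((0 : ℕ) : WithTop ℕ∞) < ν := by exact_mod_cast (by omega : 0 < ν)
    have hd := hasDerivAt_iteratedFDeriv_line hφ.2.1 hlt (EuclideanSpace.single j (1 : ℝ)) t x
    simp only [iteratedFDeriv_zero_apply] at hd
    refine (((hd.const_mul (c * l)).ofReal_comp.const_mul Complex.I).cexp).congr_deriv ?_
    push_cast
    ring

/-! ### From `ℓ²` decay to `ℓ^p` bounds -/

theorem card_le_of_abs_le {S : Finset (Fin m → ℤ)} {R : ℝ} (hR : 1 ≤ R)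
    (hS : ∀ k ∈ S, ∀ j, |(k j : ℝ)| ≤ R) : (S.card : ℝ) ≤ (3 * R) ^ m := by
  have hsub : S ⊆ Fintype.piFinset fun _ : Fin m => Finset.Icc (-⌊R⌋) ⌊R⌋ := by
    intro k hk
    rw [Fintype.mem_piFinset]
    intro j
    have h := abs_le.1 (hS k hk j)
    rw [Finset.mem_Icc]
    refine ⟨?_, Int.le_floor.2 h.2⟩
    have : -k j ≤ ⌊R⌋ := Int.le_floor.2 (by push_cast; linarith)
    linarith
  have h0 : 0 ≤ ⌊R⌋ := Int.floor_nonneg.2 (by linarith)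
  have hcard : ((Finset.Icc (-⌊R⌋) ⌊R⌋).card : ℝ) ≤ 3 * R := by
    have h1 : ((Finset.Icc (-⌊R⌋) ⌊R⌋).card : ℤ) = 2 * ⌊R⌋ + 1 := by
      rw [Int.card_Icc, Int.toNat_of_nonneg (by linarith)]
      ring
    have h2 : ((Finset.Icc (-⌊R⌋) ⌊R⌋).card : ℝ) = 2 * ⌊R⌋ + 1 := by exact_mod_cast h1
    rw [h2]
    linarith [Int.floor_le R]
  calc (S.card : ℝ) ≤ ((Fintype.piFinset fun _ : Fin m => Finset.Icc (-⌊R⌋) ⌊R⌋).card : ℝ) := by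
        exact_mod_cast Finset.card_le_card hsub
    _ = ((Finset.Icc (-⌊R⌋) ⌊R⌋).card : ℝ) ^ m := by simp [Fintype.card_piFinset]
    _ ≤ (3 * R) ^ m := by gcongr

/-- Hölder's inequality with exponent `2 / p`, in power mean form. -/
theorem sum_rpow_le_of_sum_sq_le {ι : Type*} (S : Finset ι) {a : ι → ℝ} (ha : ∀ k, 0 ≤ a k)
    {p : ℝ} (hp : 0 < p) (hp2 : p ≤ 2) {N Q : ℝ} (hN : (S.card : ℝ) ≤ N)
    (hQ : ∑ k ∈ S, a k ^ 2 ≤ Q) :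
    ∑ k ∈ S, a k ^ p ≤ N ^ (1 - p / 2) * Q ^ (p / 2) := by
  have h1 := Real.rpow_sum_le_const_mul_sum_rpow S (fun k => a k ^ p) (p := 2 / p)
    ((one_le_div hp).2 hp2)
  have habs : ∀ k, |a k ^ p| = a k ^ p := fun k => abs_of_nonneg (Real.rpow_nonneg (ha k) p)
  have hsq : ∀ k, (a k ^ p) ^ (2 / p) = a k ^ 2 := fun k => by
    rw [← Real.rpow_mul (ha k), mul_div_cancel₀ _ hp.ne', Real.rpow_two]
  simp only [habs, hsq] at h1
  have hX : 0 ≤ ∑ k ∈ S, a k ^ p := Finset.sum_nonneg fun k _ => Real.rpow_nonneg (ha k) p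
  have hQ0 : 0 ≤ ∑ k ∈ S, a k ^ 2 := Finset.sum_nonneg fun k _ => sq_nonneg (a k)
  have h2 := Real.rpow_le_rpow (Real.rpow_nonneg hX _) h1 (by positivity : 0 ≤ p / 2)
  have he : 2 / p * (p / 2) = 1 := by field_simp
  have he' : (2 / p - 1) * (p / 2) = 1 - p / 2 := by field_simp
  rw [← Real.rpow_mul hX, he, Real.rpow_one, Real.mul_rpow (by positivity) hQ0,
    ← Real.rpow_mul (by positivity), he'] at h2
  refine h2.trans (mul_le_mul ?_ ?_ (by positivity) ?_)
  · exact Real.rpow_le_rpow (by positivity) hN (by linarith)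
  · exact Real.rpow_le_rpow hQ0 hQ (by positivity)
  · exact Real.rpow_nonneg ((Nat.cast_nonneg _).trans hN) _

theorem normA_nonneg (p : ℝ) (f : EuclideanSpace ℝ (Fin m) → ℂ) : 0 ≤ normA p f :=
  Real.rpow_nonneg (tsum_nonneg fun _ => Real.rpow_nonneg (norm_nonneg _) p) _

/-- An `ℓ^p` bound from an `ℓ^2` bound together with quadratic decay in every coordinate
direction beyond the scale `l`. -/
theorem exists_sum_rpow_le (m : ℕ) {p s : ℝ} (hp : 0 < p) (hp2 : p < 2)
    (hs : (m : ℝ) * (1 / p - 1 / 2) < s) {K : ℝ} (hK : 0 ≤ K) :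
    ∃ D, 0 ≤ D ∧ ∀ (a : (Fin m → ℤ) → ℝ), (∀ k, 0 ≤ a k) → ∀ l, 1 ≤ l →
      (∀ S : Finset (Fin m → ℤ), ∑ k ∈ S, a k ^ 2 ≤ 1) →
      (∀ (j : Fin m) (T : ℝ), l ≤ T → ∀ S : Finset (Fin m → ℤ),
        (∀ k ∈ S, T ≤ |(k j : ℝ)| ∧ |(k j : ℝ)| ≤ 2 * T) →
          ∑ k ∈ S, a k ^ 2 ≤ K * ((l / T) ^ s) ^ 2) →
      ∀ S : Finset (Fin m → ℤ), ∑ k ∈ S, a k ^ p ≤ D * l ^ ((m : ℝ) * (1 - p / 2)) := by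
  set γ : ℝ := (m : ℝ) * (1 - p / 2) with hγ
  have hγs : γ - s * p < 0 := by
    have : γ = (m : ℝ) * (1 / p - 1 / 2) * p := by
      rw [hγ]
      field_simp
    rw [this]
    nlinarith
  -- Ratio of consecutive dyadic shells: the point count contributes `2 ^ γ`, the `ℓ²` decay `2 ^
  -- (-s p)`.
  set q : ℝ := 2 ^ (γ - s * p) with hq
  have hq0 : 0 < q := Real.rpow_pos_of_pos two_pos _
  have hq1 : q < 1 := Real.rpow_lt_one_of_one_lt_of_neg one_lt_two hγs
  set A : ℝ := 3 ^ γ with hA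
  set B : ℝ := 6 ^ γ * (m * K) ^ (p / 2) with hB
  have hA0 : 0 ≤ A := by positivity
  have hB0 : 0 ≤ B := by positivity
  have hpow {R : ℝ} (hR : 0 ≤ R) : (R ^ m) ^ (1 - p / 2) = R ^ γ := by
    rw [← Real.rpow_natCast, ← Real.rpow_mul hR]
  refine ⟨A + B * (1 - q)⁻¹, add_nonneg hA0 (mul_nonneg hB0 (inv_nonneg.2 (by linarith))), ?_⟩
  intro a ha l hl h2 hdec S
  have hl0 : 0 < l := by linarith
  -- Induction over the cubes of half-side `2 ^ i * l`; passing to the next cube adds one shell and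
  -- one term `B q^i l^γ`.
  have key : ∀ (i : ℕ) (S : Finset (Fin m → ℤ)), (∀ k ∈ S, ∀ j, |(k j : ℝ)| ≤ 2 ^ i * l) →
      ∑ k ∈ S, a k ^ p ≤ (A + B * ∑ n ∈ Finset.range i, q ^ n) * l ^ γ := by
    intro i
    induction i with
    | zero =>
      intro S hS
      simp only [pow_zero, one_mul] at hS
      have h3 := sum_rpow_le_of_sum_sq_le S ha hp hp2.le (card_le_of_abs_le hl hS) (h2 S)
      rw [Real.one_rpow, mul_one, hpow (by positivity), Real.mul_rpow (by norm_num) hl0.le] at h3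
      simpa using h3
    | succ i ih =>
      intro S hS
      classical
      rw [← Finset.sum_filter_add_sum_filter_not S fun k => ∀ j, |(k j : ℝ)| ≤ 2 ^ i * l]
      have h3 := ih (S.filter fun k => ∀ j, |(k j : ℝ)| ≤ 2 ^ i * l)
        fun k hk => (Finset.mem_filter.1 hk).2
      set S' := S.filter fun k => ¬∀ j, |(k j : ℝ)| ≤ 2 ^ i * l with hS'
      have hT : l ≤ 2 ^ i * l := le_mul_of_one_le_left hl0.le (one_le_pow₀ one_le_two)
      have hT0 : 0 < 2 ^ i * l := by positivity
      have hlT : l / (2 ^ i * l) = (2 ^ i)⁻¹ := by field_simp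
      -- A point of the shell lies in the slab of at least one of the `m` coordinates, hence the
      -- factor `m`.
      have hsq : ∑ k ∈ S', a k ^ 2 ≤ m * K * (((2 ^ i : ℝ)⁻¹) ^ s) ^ 2 := by
        calc ∑ k ∈ S', a k ^ 2
            ≤ ∑ k ∈ S', ∑ j : Fin m, if 2 ^ i * l ≤ |(k j : ℝ)| then a k ^ 2 else 0 := by
              refine Finset.sum_le_sum fun k hk => ?_
              obtain ⟨j, hj⟩ := not_forall.1 (Finset.mem_filter.1 hk).2
              have h4 := Finset.single_le_sum
                (f := fun j : Fin m => if 2 ^ i * l ≤ |(k j : ℝ)| then a k ^ 2 else 0)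
                (fun j _ => by positivity) (Finset.mem_univ j)
              rwa [if_pos (not_le.1 hj).le] at h4
          _ = ∑ j : Fin m, ∑ k ∈ S'.filter fun k => 2 ^ i * l ≤ |(k j : ℝ)|, a k ^ 2 := by
              rw [Finset.sum_comm]
              simp only [Finset.sum_filter]
          _ ≤ ∑ _j : Fin m, K * (((2 ^ i : ℝ)⁻¹) ^ s) ^ 2 := by
              refine Finset.sum_le_sum fun j _ => ?_
              rw [← hlT]
              refine hdec j _ hT _ fun k hk => ?_
              rw [Finset.mem_filter, hS', Finset.mem_filter] at hk
              refine ⟨hk.2, (hS k hk.1.1 j).trans_eq ?_⟩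
              rw [pow_succ']
              ring
          _ = _ := by simp [mul_assoc]
      have h4 := sum_rpow_le_of_sum_sq_le S' ha hp hp2.le
        (card_le_of_abs_le (R := 2 ^ (i + 1) * l)
          (hl.trans (le_mul_of_one_le_left hl0.le (one_le_pow₀ one_le_two)))
          fun k hk => hS k (Finset.mem_filter.1 hk).1) hsq
      have h5 : (((3 * (2 ^ (i + 1) * l)) ^ m) ^ (1 - p / 2)) = 6 ^ γ * (2 ^ γ) ^ i * l ^ γ := by
        rw [hpow (by positivity), show 3 * (2 ^ (i + 1) * l) = 6 * 2 ^ i * l by ring,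
          Real.mul_rpow (by positivity) hl0.le, Real.mul_rpow (by norm_num) (by positivity),
          ← Real.rpow_pow_comm two_pos.le]
      have h6 : (m * K * (((2 ^ i : ℝ)⁻¹) ^ s) ^ 2) ^ (p / 2) =
          (m * K) ^ (p / 2) * (2 ^ (-(s * p))) ^ i := by
        have h7 : (((2 ^ i : ℝ)⁻¹) ^ s) ^ 2 = 2 ^ (-(i * s * 2)) := by
          rw [← Real.rpow_natCast, ← Real.rpow_natCast, ← Real.rpow_neg two_pos.le,
            ← Real.rpow_mul two_pos.le, ← Real.rpow_mul two_pos.le]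
          congr 1
          push_cast
          ring
        rw [Real.mul_rpow (by positivity) (by positivity), h7, ← Real.rpow_mul two_pos.le,
          ← Real.rpow_natCast, ← Real.rpow_mul two_pos.le]
        congr 2
        ring
      rw [h5, h6] at h4
      have h8 : q ^ i = (2 ^ γ) ^ i * (2 ^ (-(s * p))) ^ i := by
        rw [← mul_pow, ← Real.rpow_add two_pos, ← sub_eq_add_neg]
      calc _ ≤ _ := add_le_add h3 h4
        _ = _ := by
          rw [Finset.sum_range_succ, h8]
          ring
  -- Every finite set lies in some dyadic cube, and the partial geometric sums are bounded
  -- independently of it.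
  obtain ⟨M, hM⟩ : ∃ M : ℝ, ∀ k ∈ S, ∀ j, |(k j : ℝ)| ≤ M := by
    refine ⟨∑ k ∈ S, ∑ j, |(k j : ℝ)|, fun k hk j => ?_⟩
    exact (Finset.single_le_sum (f := fun j => |(k j : ℝ)|) (fun _ _ => abs_nonneg _)
      (Finset.mem_univ j)).trans (Finset.single_le_sum (f := fun k : Fin m → ℤ => ∑ j, |(k j : ℝ)|)
        (fun _ _ => Finset.sum_nonneg fun _ _ => abs_nonneg _) hk)
  obtain ⟨i, hi⟩ := pow_unbounded_of_one_lt M one_lt_two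
  refine (key i S fun k hk j => (hM k hk j).trans (hi.le.trans
    (le_mul_of_one_le_right (by positivity) hl))).trans ?_
  gcongr
  rw [← tsum_geometric_of_lt_one hq0.le hq1]
  exact (summable_geometric_of_lt_one hq0.le hq1).sum_le_tsum _ fun _ _ => by positivity

/-! ### Conclusion for the exponentials -/

/-- For fixed `c`, the `ℓ^p` sums of the Fourier coefficients of `e^{iclφ}` grow at most like
`l^{m(1 - p/2)}`. -/
theorem MemC.exists_sum_fourierCoef_rpow_le {p : ℝ} (hp1 : 1 ≤ p) (hp2 : p < 2)
    {ν : ℕ} {α : ℝ} (hα0 : 0 ≤ α) (hα1 : α ≤ 1) {φ : EuclideanSpace ℝ (Fin m) → ℝ}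
    (hφ : MemC ν α φ) (h1 : 1 ≤ (ν : ℝ) + α) (h2 : (m : ℝ) * (1 / p - 1 / 2) < (ν : ℝ) + α)
    (c : ℝ) :
    ∃ D, 0 ≤ D ∧ ∀ l, 1 ≤ l → ∀ S : Finset (Fin m → ℤ),
      ∑ k ∈ S, ‖fourierCoef (fun t => Complex.exp (Complex.I * ((c * l * φ t : ℝ) : ℂ))) k‖ ^ p ≤
        D * l ^ ((m : ℝ) * (1 - p / 2)) := by
  choose C hC using fun j => (hφ.smoothFamily_exp hα0 hα1 h1 j c).exists_sum_sq_le
  obtain ⟨D, hD0, hD⟩ := exists_sum_rpow_le m (zero_lt_one.trans_le hp1) hp2 h2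
    (K := ∑ j, |C j|) (Finset.sum_nonneg fun _ _ => abs_nonneg _)
  refine ⟨D, hD0, fun l hl S => hD _ (fun k => norm_nonneg _) l hl (fun S => ?_)
    (fun j T hT S hS => (hC j l hl T hT S hS).trans ?_) S⟩
  · have hφc : Continuous φ := hφ.2.1.continuous
    refine (sum_norm_fourierCoef_sq_le (C := 1) (by fun_prop) (fun t => ?_) S).trans (by norm_num)
    rw [mul_comm, Complex.norm_exp_ofReal_mul_I]
  · gcongr
    exact (le_abs_self _).trans (Finset.single_le_sum (f := fun j => |C j|)
      (fun _ _ => abs_nonneg _) (Finset.mem_univ j))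

theorem MemC.exists_summable_normA_le {p : ℝ} (hp1 : 1 ≤ p) (hp2 : p < 2)
    {ν : ℕ} {α : ℝ} (hα0 : 0 ≤ α) (hα1 : α ≤ 1) {φ : EuclideanSpace ℝ (Fin m) → ℝ}
    (hφ : MemC ν α φ) (h1 : 1 ≤ (ν : ℝ) + α) (h2 : (m : ℝ) * (1 / p - 1 / 2) < (ν : ℝ) + α)
    (c : ℝ) :
    ∃ D, ∀ l, 1 ≤ l →
      (Summable fun k => ‖fourierCoef
        (fun t => Complex.exp (Complex.I * ((c * l * φ t : ℝ) : ℂ))) k‖ ^ p) ∧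
      normA p (fun t => Complex.exp (Complex.I * ((c * l * φ t : ℝ) : ℂ))) ≤
        D * l ^ ((m : ℝ) * (1 / p - 1 / 2)) := by
  obtain ⟨D, hD0, hD⟩ := hφ.exists_sum_fourierCoef_rpow_le hp1 hp2 hα0 hα1 h1 h2 c
  have hp0 : 0 < p := by linarith
  refine ⟨D ^ (1 / p), fun l hl => ?_⟩
  have hl0 : 0 ≤ l := by linarith
  have hnn : ∀ k, 0 ≤ ‖fourierCoef
      (fun t => Complex.exp (Complex.I * ((c * l * φ t : ℝ) : ℂ))) k‖ ^ p :=
    fun k => Real.rpow_nonneg (norm_nonneg _) p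
  have hsum := summable_of_sum_le hnn (hD l hl)
  refine ⟨hsum, ?_⟩
  have he : (m : ℝ) * (1 / p - 1 / 2) = (m : ℝ) * (1 - p / 2) * (1 / p) := by field_simp
  rw [he, Real.rpow_mul hl0, ← Real.mul_rpow hD0 (by positivity)]
  exact Real.rpow_le_rpow (tsum_nonneg hnn) (hsum.tsum_le_of_sum_le (hD l hl)) (by positivity)

end TorusAp

theorem theorem3 (m : ℕ) (hm : 1 ≤ m) (p : ℝ) (hp1 : 1 ≤ p) (hp2 : p < 2)
    (ν : ℕ) (α : ℝ) (hα0 : 0 ≤ α) (hα1 : α ≤ 1)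
    (φ : EuclideanSpace ℝ (Fin m) → ℝ) (hφ : TorusAp.MemC ν α φ)
    (h1 : 1 ≤ (ν : ℝ) + α) (h2 : (m : ℝ) * (1 / p - 1 / 2) < (ν : ℝ) + α) :
    (∀ l : ℝ, TorusAp.MemA p
      (fun t : EuclideanSpace ℝ (Fin m) => Complex.exp (Complex.I * ((l * φ t : ℝ) : ℂ)))) ∧
    Asymptotics.IsBigO (Filter.comap (fun l : ℝ => |l|) Filter.atTop)
      (fun l : ℝ => TorusAp.normA p
        (fun t : EuclideanSpace ℝ (Fin m) => Complex.exp (Complex.I * ((l * φ t : ℝ) : ℂ))))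
      (fun l : ℝ => |l| ^ ((m : ℝ) * (1 / p - 1 / 2))) := by
  have hφc : Continuous φ := hφ.2.1.continuous
  have key := hφ.exists_summable_normA_le hp1 hp2 hα0 hα1 h1 h2
  refine ⟨fun l => ⟨fun i t => by simp only [hφ.1 i t],
    TorusAp.integrableOn_cube (by fun_prop), fun _ => by fun_prop, ?_⟩, ?_⟩
  -- The free constant `c` absorbs any real frequency at `l = 1`; the asymptotics below use `c = 1`
  -- and `c = -1` with parameter `|l|`.
  · obtain ⟨D, hD⟩ := key l
    simpa using (hD 1 le_rfl).1
  · obtain ⟨D, hD⟩ := key 1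
    obtain ⟨D', hD'⟩ := key (-1)
    refine Asymptotics.IsBigO.of_bound (max D D') ?_
    have hev : ∀ᶠ l : ℝ in Filter.comap (fun l : ℝ => |l|) Filter.atTop, 1 ≤ |l| :=
      Filter.tendsto_comap.eventually (Filter.eventually_ge_atTop 1)
    filter_upwards [hev] with l hl
    rw [Real.norm_of_nonneg (TorusAp.normA_nonneg _ _), Real.norm_of_nonneg (by positivity)]
    rcases abs_cases l with ⟨h, -⟩ | ⟨h, -⟩
    · have h3 := (hD |l| hl).2
      rw [h] at h3 ⊢
      simp only [one_mul] at h3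
      exact h3.trans (by gcongr; exacts [Real.rpow_nonneg (h ▸ abs_nonneg l) _, le_max_left _ _])
    · have h3 := (hD' |l| hl).2
      simp only [h, mul_neg, neg_mul, neg_neg, one_mul] at h3 ⊢
      exact h3.trans (by
        gcongr; exacts [Real.rpow_nonneg (h ▸ abs_nonneg l) _, le_max_right _ _])
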